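/- Let $\mathcal H$ be a real Hilbert space and let $f:\mathcal H\to\mathbb R$ be convex and continuously differentiable, with $\operatorname{argmin}_{\mathcal H} f\neq\emptyset$. Let $\alpha\in\mathbb R$ and $t_0>0$, and let $u:[t_0,+\infty[\,\to\mathcal H$ be any classical (that is, $\mathcal C^3$) solution of $$\dddot u(t)+\frac{\alpha+7}{t}\ddot u(t)+\frac{5(\alpha+1)}{t^2}\dot u(t)+\nabla f\Big(u(t)+\frac14 t\,\dot u(t)\Big)=0,\qquad t\ge t_0. \tag{TOGES-V}$$ a) If $\alpha\ge 3$, then, as $t\to+\infty$, - (i) $f\big(u(t)+\frac14 t\,\dot u(t)\big)-\inf_{\mathcal H}f=\mathcal O\big(1/t^3\big)$; - (ii) $f(u(t))-\inf_{\mathcal H}f=\mathcal O\big(1/t^3\big)$. b) If $\alpha>3$, then, as $t\to+\infty$, - (iii) $f\big(u(t)+\frac14 t\,\dot u(t)\big)-\inf_{\mathcal H}f=o\big(1/t^3\big)$; - (iv) $f(u(t))-\inf_{\mathcal H}f=o\big(1/t^3\big)$; - (v) $u(t)$ converges weakly to some $u_\infty\in\operatorname{argmin}_{\mathcal H}f$.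 -/

import Mathlib

open Set Filter Topology Asymptotics

/-- The set of global minimizers of `f`. -/
def argmin {H : Type*} (f : H → ℝ) : Set H := {z | IsMinOn f univ z}

/-- `u : [t₀, +∞[ → H` is a classical global solution of
`u''' + ((α + 7) / t) u'' + (5 (α + 1) / t²) u' + ∇f (u + (t / 4) u') = 0`.
Only the values of `u` on `[t₀, +∞[` matter; derivatives at `t₀` are one-sided. -/
structure IsTogesVSolution {H : Type*} [NormedAddCommGroup H] [InnerProductSpace ℝ H]
    [CompleteSpace H] (α t₀ : ℝ) (f : H → ℝ) (u : ℝ → H) : Prop where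
  contDiffOn : ContDiffOn ℝ 3 u (Ici t₀)
  eqn : ∀ t ∈ Ici t₀,
    iteratedDerivWithin 3 u (Ici t₀) t
      + ((α + 7) / t) • iteratedDerivWithin 2 u (Ici t₀) t
      + (5 * (α + 1) / t ^ 2) • derivWithin u (Ici t₀) t
      + gradient f (u t + (t / 4) • derivWithin u (Ici t₀) t) = 0

/-- `u t` converges weakly to `x` as `t → +∞`. -/
def WeaklyConvergesTo {H : Type*} [NormedAddCommGroup H] [InnerProductSpace ℝ H]
    (u : ℝ → H) (x : H) : Prop :=
  Tendsto (fun t => toWeakSpace ℝ H (u t)) atTop (𝓝 (toWeakSpace ℝ H x))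

/-! ### Monotonicity on half-lines -/

/-! Put v = u + (t/4)u'. The third order equation becomes v'' + ((α+1)/t)v' + (t/4)∇f(v) = 0. For a
minimizer z, `anchoredEnergy` is nonincreasing when α ≥ 3, since convexity bounds its derivative by
-((α-3)/4)t²(f(v) - f(z)); this gives the O(1/t³) rate along v.

For α > 3 that dissipation pays for the growth of `mechanicalEnergy` W: a combination of the two
energies decreases at rate at least W/t. So W converges, and its limit is 0 because 1/t is not
integrable. Hence f(v) - f(z) = o(1/t³) and tv' → 0, so ‖v - z‖ converges, and Opial's lemma gives
the weak limit of v.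

Everything passes back to u through 4u + tu' = 4v, which makes u a weighted average of v; for
values, convexity gives f(u) + (t/4)(f∘u)' ≤ f(v). -/

theorem antitoneOn_Ioi_of_hasDerivAt_nonpos {a : ℝ} {F F' : ℝ → ℝ}
    (hF : ∀ t, a < t → HasDerivAt F (F' t) t) (hF' : ∀ t, a < t → F' t ≤ 0) :
    AntitoneOn F (Ioi a) := by
  refine antitoneOn_of_deriv_nonpos (convex_Ioi a)
    (fun t ht => (hF t ht).continuousAt.continuousWithinAt)
    (fun t ht => ?_) (fun t ht => ?_)
  · rw [interior_Ioi] at ht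
    exact (hF t ht).differentiableAt.differentiableWithinAt
  · rw [interior_Ioi] at ht
    rw [(hF t ht).deriv]
    exact hF' t ht

theorem exists_tendsto_of_antitoneOn_Ioi {a B : ℝ} {F : ℝ → ℝ} (hF : AntitoneOn F (Ioi a))
    (hB : ∀ t, a < t → B ≤ F t) : ∃ L, Tendsto F atTop (𝓝 L) := by
  have hmem : ∀ t : ℝ, a < max t (a + 1) := fun t => lt_max_of_lt_right (lt_add_one a)
  have hanti : Antitone fun t => F (max t (a + 1)) := fun s t hst =>
    hF (hmem s) (hmem t) (max_le_max_right _ hst)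
  have hbdd : BddBelow (range fun t => F (max t (a + 1))) := by
    refine ⟨B, ?_⟩
    rintro _ ⟨t, rfl⟩
    exact hB _ (hmem t)
  refine ⟨_, (tendsto_atTop_ciInf hanti hbdd).congr' ?_⟩
  filter_upwards [eventually_ge_atTop (a + 1)] with t ht
  rw [max_eq_left ht]

/-- If `c y + t y'` is eventually at most `K`, then `limsup y ≤ K / c`. -/
theorem eventually_le_of_damped_ineq {a K ε : ℝ} (ha : 0 ≤ a) {n : ℕ} {y y' : ℝ → ℝ}
    (hy : ∀ t, a < t → HasDerivAt y (y' t) t)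
    (hK : ∀ᶠ t in atTop, (n + 1 : ℝ) * y t + t * y' t ≤ K) (hε : 0 < ε) :
    ∀ᶠ t in atTop, y t ≤ K / (n + 1) + ε := by
  obtain ⟨b, hb⟩ := eventually_atTop.1 hK
  set s := max a b with hs
  -- Integrating factor: F' = tⁿ((n+1)y + ty' - K) ≤ 0.
  set F : ℝ → ℝ := fun t => t ^ (n + 1) * (y t - K / (n + 1)) with hF
  have hn : (0 : ℝ) < n + 1 := by positivity
  have hanti : AntitoneOn F (Ioi s) := by
    refine antitoneOn_Ioi_of_hasDerivAt_nonpos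
      (F' := fun t => t ^ n * ((n + 1) * y t + t * y' t - K)) (fun t ht => ?_) (fun t ht => ?_)
    · have h := (hasDerivAt_pow (n + 1) t).mul
        ((hy t (lt_of_le_of_lt (le_max_left a b) ht)).sub_const (K / (n + 1)))
      refine h.congr_deriv ?_
      push_cast
      field_simp
      ring
    · have hat : a < t := lt_of_le_of_lt (le_max_left a b) ht
      have hbt : b < t := lt_of_le_of_lt (le_max_right a b) ht
      have ht0 : 0 < t := lt_of_le_of_lt ha hat
      exact mul_nonpos_of_nonneg_of_nonpos (by positivity) (by linarith [hb t hbt.le])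
  have hlim : Tendsto (fun t : ℝ => F (s + 1) / t ^ (n + 1)) atTop (𝓝 0) :=
    tendsto_const_nhds.div_atTop (tendsto_pow_atTop (Nat.succ_ne_zero n))
  filter_upwards [hlim.eventually_lt_const hε, eventually_ge_atTop (s + 1)] with t ht hst
  have has : 0 ≤ s := ha.trans (le_max_left a b)
  have ht0 : 0 < t := by linarith
  have h1 : F t ≤ F (s + 1) := hanti (lt_add_one s) (show s < t by linarith) hst
  have h2 : y t - K / (n + 1) ≤ F (s + 1) / t ^ (n + 1) := by
    rw [le_div_iff₀ (by positivity), mul_comm]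
    exact h1
  linarith

theorem tendsto_zero_of_damped {a : ℝ} (ha : 0 ≤ a) {n : ℕ} {y y' : ℝ → ℝ}
    (hy : ∀ t, a < t → HasDerivAt y (y' t) t)
    (h0 : Tendsto (fun t => (n + 1 : ℝ) * y t + t * y' t) atTop (𝓝 0)) :
    Tendsto y atTop (𝓝 0) := by
  have hn : (0 : ℝ) < n + 1 := by positivity
  refine tendsto_order.2 ⟨fun l hl => ?_, fun r hr => ?_⟩
  · have hK : ∀ᶠ t in atTop, (n + 1 : ℝ) * (-y t) + t * (-y' t) ≤ (n + 1) * (-l / 3) := by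
      filter_upwards [h0.eventually_const_lt (show (n + 1) * (l / 3) < 0 by nlinarith)] with t ht
      linarith
    filter_upwards [eventually_le_of_damped_ineq ha (fun t ht => (hy t ht).fun_neg) hK
      (show 0 < -l / 3 by linarith)] with t ht
    rw [mul_div_cancel_left₀ _ hn.ne'] at ht
    linarith
  · have hK : ∀ᶠ t in atTop, (n + 1 : ℝ) * y t + t * y' t ≤ (n + 1) * (r / 3) :=
      h0.eventually_le_const (by positivity)
    filter_upwards [eventually_le_of_damped_ineq ha hy hK (show 0 < r / 3 by linarith)] with t ht
    rw [mul_div_cancel_left₀ _ hn.ne'] at ht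
    linarith

/-- A function bounded below cannot decrease at least at the rate `c / t`. -/
theorem not_hasDerivAt_le_neg_div {a B c : ℝ} (ha : 0 ≤ a) (hc : 0 < c) {F F' : ℝ → ℝ}
    (hF : ∀ t, a < t → HasDerivAt F (F' t) t) (hB : ∀ t, a < t → B ≤ F t)
    (hF' : ∀ t, a < t → F' t ≤ -(c / t)) : False := by
  -- The rate c/t integrates to c log t, which is unbounded.
  have hanti : AntitoneOn (fun t => F t + c * Real.log t) (Ioi a) := by
    refine antitoneOn_Ioi_of_hasDerivAt_nonpos
      (fun t ht => (hF t ht).add ((Real.hasDerivAt_log (ha.trans_lt ht).ne').const_mul c))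
      (fun t ht => ?_)
    have := hF' t ht
    rw [div_eq_mul_inv] at this
    linarith
  have hlog : Tendsto (fun t => c * Real.log t) atTop atTop :=
    Real.tendsto_log_atTop.const_mul_atTop hc
  obtain ⟨t, ht1, ht2⟩ := ((hlog.eventually_gt_atTop
    (F (a + 1) + c * Real.log (a + 1) - B)).and (eventually_ge_atTop (a + 1))).exists
  have hat : a < t := by linarith
  have h1 := hanti (show a < a + 1 by linarith) hat ht2
  have h2 := hB t hat
  simp only at h1
  linarith

/-! ### Convex differentiable functions and weak convergence -/

section Hilbert

variable {H : Type*} [NormedAddCommGroup H] [InnerProductSpace ℝ H] [CompleteSpace H]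

theorem HasGradientAt.comp_hasDerivAt' {f : H → ℝ} {g : H} {v : ℝ → H} {v' : H} {t : ℝ}
    (hf : HasGradientAt f g (v t)) (hv : HasDerivAt v v' t) :
    HasDerivAt (fun s => f (v s)) (inner ℝ g v') t := by
  have h := hf.hasFDerivAt.comp_hasDerivAt t hv
  rwa [InnerProductSpace.toDual_apply_apply] at h

theorem ConvexOn.inner_gradient_le {f : H → ℝ} (hf : ConvexOn ℝ univ f) {g x : H}
    (hg : HasGradientAt f g x) (y : H) : f x + inner ℝ g (y - x) ≤ f y := by
  have hline : HasDerivAt (fun s : ℝ => f (AffineMap.lineMap x y s)) (inner ℝ g (y - x)) 0 := by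
    refine HasGradientAt.comp_hasDerivAt' (v := fun s : ℝ => AffineMap.lineMap x y s) ?_ ?_
    · simpa using hg
    · exact AffineMap.hasDerivAt_lineMap
  have hconv : ConvexOn ℝ univ (fun s : ℝ => f (AffineMap.lineMap x y s)) :=
    hf.comp_affineMap (AffineMap.lineMap x y)
  have h := hconv.le_slope_of_hasDerivAt (mem_univ (0 : ℝ)) (mem_univ 1) one_pos hline
  simp [slope_def_field] at h
  linarith

/-- Bounded ultrafilters in a Hilbert space converge weakly. -/
theorem exists_weak_limit_of_bounded {ι : Type*} (U : Ultrafilter ι) {v : ι → H} {R : ℝ}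
    (hv : ∀ᶠ i in (U : Filter ι), ‖v i‖ ≤ R) :
    ∃ x : H, ∀ h : H, Tendsto (fun i => inner ℝ (v i) h) U (𝓝 (inner ℝ x h)) := by
  -- Riesz representation moves the family into the dual, where Banach–Alaoglu applies.
  set w : ι → WeakDual ℝ H := fun i =>
    StrongDual.toWeakDual (InnerProductSpace.toDual ℝ H (v i)) with hw
  have hmem : ∀ᶠ i in (U : Filter ι),
      w i ∈ WeakDual.toStrongDual ⁻¹' Metric.closedBall (0 : StrongDual ℝ H) R := by
    filter_upwards [hv] with i hi
    simpa [hw] using hi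
  obtain ⟨p, -, hp⟩ := (WeakDual.isCompact_closedBall (𝕜 := ℝ) (0 : StrongDual ℝ H) R)
    |>.ultrafilter_le_nhds (U.map w) (le_principal_iff.2 hmem)
  refine ⟨(InnerProductSpace.toDual ℝ H).symm (WeakDual.toStrongDual p), fun h => ?_⟩
  have hp' : Tendsto w U (𝓝 p) := hp
  rw [InnerProductSpace.toDual_symm_apply]
  exact ((WeakDual.eval_continuous h).tendsto p).comp hp'

/-- Opial's lemma. -/
theorem exists_weak_limit_of_opial {ι : Type*} {l : Filter ι} [l.NeBot] {v : ι → H} {S : Set H}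
    (hS : S.Nonempty)
    (hnorm : ∀ z ∈ S, ∃ c : ℝ, Tendsto (fun i => ‖v i - z‖ ^ 2) l (𝓝 c))
    (hcluster : ∀ U : Ultrafilter ι, (U : Filter ι) ≤ l → ∀ x : H,
      (∀ h : H, Tendsto (fun i => inner ℝ (v i) h) U (𝓝 (inner ℝ x h))) → x ∈ S) :
    ∃ x ∈ S, ∀ h : H, Tendsto (fun i => inner ℝ (v i) h) l (𝓝 (inner ℝ x h)) := by
  obtain ⟨z, hz⟩ := hS
  obtain ⟨c, hc⟩ := hnorm z hz
  have hbdd : ∀ᶠ i in l, ‖v i‖ ≤ (c + 2) + ‖z‖ := by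
    filter_upwards [hc.eventually_lt_const (lt_add_one c)] with i hi
    have h1 : ‖v i‖ ≤ ‖v i - z‖ + ‖z‖ := by
      simpa using norm_add_le (v i - z) z
    -- Uses 2r ≤ r² + 1 with r = ‖v i - z‖, avoiding a square root.
    nlinarith [sq_nonneg (‖v i - z‖ - 1)]
  have hlim : ∀ U : Ultrafilter ι, (U : Filter ι) ≤ l → ∃ x ∈ S,
      ∀ h : H, Tendsto (fun i => inner ℝ (v i) h) U (𝓝 (inner ℝ x h)) := fun U hU => by
    obtain ⟨x, hx⟩ := exists_weak_limit_of_bounded U (hbdd.filter_mono hU)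
    exact ⟨x, hcluster U hU x hx, hx⟩
  have huniq : ∀ U V : Ultrafilter ι, (U : Filter ι) ≤ l → (V : Filter ι) ≤ l →
      ∀ x ∈ S, ∀ y ∈ S,
      (∀ h : H, Tendsto (fun i => inner ℝ (v i) h) U (𝓝 (inner ℝ x h))) →
      (∀ h : H, Tendsto (fun i => inner ℝ (v i) h) V (𝓝 (inner ℝ y h))) → x = y := by
    intro U V hU hV x hx y hy hxU hyV
    obtain ⟨cx, hcx⟩ := hnorm x hx
    obtain ⟨cy, hcy⟩ := hnorm y hy
    -- In ‖v - y‖² - ‖v - x‖² the term ‖v‖² cancels, so ⟨v, x - y⟩ has a limit along all of `l`, and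
    -- both weak limits must agree with it.
    have hd : Tendsto (fun i => inner ℝ (v i) (x - y)) l
        (𝓝 ((cy - cx + (‖x‖ ^ 2 - ‖y‖ ^ 2)) / 2)) := by
      refine (((hcy.sub hcx).add_const (‖x‖ ^ 2 - ‖y‖ ^ 2)).div_const 2).congr fun i => ?_
      rw [norm_sub_sq_real, norm_sub_sq_real, inner_sub_right]
      ring
    have h1 := tendsto_nhds_unique (hxU (x - y)) (hd.mono_left hU)
    have h2 := tendsto_nhds_unique (hyV (x - y)) (hd.mono_left hV)
    have h3 : inner ℝ (x - y) (x - y) = 0 := by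
      rw [inner_sub_left, h1, h2, sub_self]
    exact sub_eq_zero.1 (inner_self_eq_zero.1 h3)
  obtain ⟨x, hxS, hx⟩ := hlim (Ultrafilter.of l) (Ultrafilter.of_le l)
  refine ⟨x, hxS, fun h => tendsto_iff_ultrafilter _ _ _ |>.2 fun U hU => ?_⟩
  obtain ⟨y, hyS, hy⟩ := hlim U hU
  rw [huniq _ U (Ultrafilter.of_le l) hU x hxS y hyS hx hy]
  exact hy h

theorem weaklyConvergesTo_of_forall_inner {u : ℝ → H} {x : H}
    (h : ∀ w : H, Tendsto (fun t => inner ℝ (u t) w) atTop (𝓝 (inner ℝ x w))) :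
    WeaklyConvergesTo u x := by
  refine (WeakBilin.tendsto_iff_forall_eval_tendsto _
    (separatingDual_iff_injective.1 inferInstance)).2 fun φ => ?_
  have hφ : ∀ y : H, inner ℝ y ((InnerProductSpace.toDual ℝ H).symm φ) = φ y := fun y => by
    rw [real_inner_comm, InnerProductSpace.toDual_symm_apply]
  have := h ((InnerProductSpace.toDual ℝ H).symm φ)
  simp only [hφ] at this
  exact this

end Hilbert

/-! ### The second order system `v'' + ((α + 1) / t) v' + (t / 4) ∇f(v) = 0` -/

section Energy

variable {H : Type*} [NormedAddCommGroup H]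

/-- The scaled mechanical energy `(t³ / 4) (f(v) - f(z)) + t² ‖v'‖² / 2`. -/
noncomputable def mechanicalEnergy (f : H → ℝ) (z : H) (v v' : ℝ → H) (t : ℝ) : ℝ :=
  t ^ 3 / 4 * (f (v t) - f z) + t ^ 2 / 2 * ‖v' t‖ ^ 2

theorem mechanicalEnergy_nonneg {f : H → ℝ} {z : H} {v v' : ℝ → H} (hz : z ∈ argmin f)
    {t : ℝ} (ht : 0 ≤ t) : 0 ≤ mechanicalEnergy f z v v' t := by
  have : 0 ≤ f (v t) - f z := sub_nonneg.2 (hz (mem_univ (v t)))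
  unfold mechanicalEnergy
  positivity

variable [InnerProductSpace ℝ H]

/-- The anchored energy `(t³ / 4) (f(v) - f(z)) + ‖α (v - z) + t v'‖² / 2`. -/
noncomputable def anchoredEnergy (α : ℝ) (f : H → ℝ) (z : H) (v v' : ℝ → H) (t : ℝ) : ℝ :=
  t ^ 3 / 4 * (f (v t) - f z) + 1 / 2 * ‖α • (v t - z) + t • v' t‖ ^ 2

theorem anchoredEnergy_nonneg {α : ℝ} {f : H → ℝ} {z : H} {v v' : ℝ → H}
    (hz : z ∈ argmin f) {t : ℝ} (ht : 0 ≤ t) : 0 ≤ anchoredEnergy α f z v v' t := by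
  have : 0 ≤ f (v t) - f z := sub_nonneg.2 (hz (mem_univ (v t)))
  unfold anchoredEnergy
  positivity

end Energy

section Dynamics

variable {H : Type*} [NormedAddCommGroup H] [InnerProductSpace ℝ H] [CompleteSpace H]

/-- `v` solves `v'' + ((α + 1) / t) v' + (t / 4) ∇f(v) = 0` on `]t₀, +∞[`, with derivative `v'`. -/
structure IsScaledInertialSolution (α t₀ : ℝ) (f : H → ℝ) (v v' : ℝ → H) : Prop where
  hasDerivAt : ∀ t, t₀ < t → HasDerivAt v (v' t) t
  hasDerivAt_deriv : ∀ t, t₀ < t →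
    HasDerivAt v' (-(((α + 1) / t) • v' t) - (t / 4) • gradient f (v t)) t

namespace IsScaledInertialSolution

variable {α t₀ : ℝ} {f : H → ℝ} {v v' : ℝ → H} {z : H}

theorem hasDerivAt_value (hv : IsScaledInertialSolution α t₀ f v v') (hd : Differentiable ℝ f)
    {t : ℝ} (ht : t₀ < t) :
    HasDerivAt (fun s => f (v s)) (inner ℝ (gradient f (v t)) (v' t)) t :=
  (hd (v t)).hasGradientAt.comp_hasDerivAt' (hv.hasDerivAt t ht)

theorem hasDerivAt_potential (hv : IsScaledInertialSolution α t₀ f v v')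
    (hd : Differentiable ℝ f) (z : H) {t : ℝ} (ht : t₀ < t) :
    HasDerivAt (fun s => s ^ 3 / 4 * (f (v s) - f z))
      (3 / 4 * t ^ 2 * (f (v t) - f z) + t ^ 3 / 4 * inner ℝ (gradient f (v t)) (v' t)) t := by
  refine (((hasDerivAt_pow 3 t).div_const 4).mul
    ((hv.hasDerivAt_value hd ht).sub_const (f z))).congr_deriv ?_
  simp only [Nat.reduceSub, Nat.cast_ofNat]
  ring

theorem hasDerivAt_anchoredEnergy (hv : IsScaledInertialSolution α t₀ f v v') (h0 : 0 ≤ t₀)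
    (hd : Differentiable ℝ f) (z : H) {t : ℝ} (ht : t₀ < t) :
    HasDerivAt (anchoredEnergy α f z v v')
      (3 / 4 * t ^ 2 * (f (v t) - f z) - α / 4 * t ^ 2 * inner ℝ (gradient f (v t)) (v t - z))
      t := by
  have ht0 : t ≠ 0 := (h0.trans_lt ht).ne'
  -- The weight α makes this derivative (α+1)v' + tv'', from which the equation removes v'. Its
  -- pairing with tv' then cancels the ⟨∇f(v), v'⟩ term of the potential.
  have hw : HasDerivAt (fun s => α • (v s - z) + s • v' s)
      (-((t ^ 2 / 4) • gradient f (v t))) t := by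
    refine ((((hv.hasDerivAt t ht).sub_const z).const_smul α).add
      ((hasDerivAt_id t).smul (hv.hasDerivAt_deriv t ht))).congr_deriv ?_
    simp only [id]
    match_scalars <;> field_simp
    ring
  refine ((hv.hasDerivAt_potential hd z ht).add (hw.norm_sq.const_mul (1 / 2))).congr_deriv ?_
  simp only [inner_neg_right, inner_add_left, real_inner_smul_right,
    real_inner_comm (gradient f (v t))]
  ring

theorem hasDerivAt_mechanicalEnergy (hv : IsScaledInertialSolution α t₀ f v v') (h0 : 0 ≤ t₀)
    (hd : Differentiable ℝ f) (z : H) {t : ℝ} (ht : t₀ < t) :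
    HasDerivAt (mechanicalEnergy f z v v')
      (3 / 4 * t ^ 2 * (f (v t) - f z) - α * t * ‖v' t‖ ^ 2) t := by
  have ht0 : t ≠ 0 := (h0.trans_lt ht).ne'
  refine ((hv.hasDerivAt_potential hd z ht).add (((hasDerivAt_pow 2 t).div_const 2).mul
    (hv.hasDerivAt_deriv t ht).norm_sq)).congr_deriv ?_
  simp only [inner_sub_right, inner_neg_right, real_inner_smul_right, real_inner_self_eq_norm_sq,
    real_inner_comm (gradient f (v t))]
  norm_num
  field_simp
  ring

theorem anchoredEnergy_deriv_le (hconv : ConvexOn ℝ univ f) (hd : Differentiable ℝ f)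
    (hα : 0 ≤ α) (z : H) (v : ℝ → H) (t : ℝ) :
    3 / 4 * t ^ 2 * (f (v t) - f z) - α / 4 * t ^ 2 * inner ℝ (gradient f (v t)) (v t - z)
      ≤ -((α - 3) / 4 * (t ^ 2 * (f (v t) - f z))) := by
  have h := hconv.inner_gradient_le (hd (v t)).hasGradientAt z
  rw [← neg_sub (v t) z, inner_neg_right] at h
  have := mul_le_mul_of_nonneg_left
    (show f (v t) - f z ≤ inner ℝ (gradient f (v t)) (v t - z) by linarith)
    (show 0 ≤ α / 4 * t ^ 2 by positivity)
  linarith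

theorem exists_tendsto_anchoredEnergy (hv : IsScaledInertialSolution α t₀ f v v') (h0 : 0 ≤ t₀)
    (hconv : ConvexOn ℝ univ f) (hd : Differentiable ℝ f) (hz : z ∈ argmin f) (hα : 3 ≤ α) :
    ∃ L, Tendsto (anchoredEnergy α f z v v') atTop (𝓝 L) := by
  refine exists_tendsto_of_antitoneOn_Ioi (a := t₀) (B := 0)
    (antitoneOn_Ioi_of_hasDerivAt_nonpos (fun t ht => hv.hasDerivAt_anchoredEnergy h0 hd z ht)
      fun t ht => ?_) (fun t ht => anchoredEnergy_nonneg hz (h0.trans ht.le))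
  refine (anchoredEnergy_deriv_le hconv hd (by linarith) z v t).trans ?_
  have h1 : 0 ≤ f (v t) - f z := sub_nonneg.2 (hz (mem_univ (v t)))
  have h2 : 0 ≤ α - 3 := by linarith
  rw [neg_nonpos]
  positivity

theorem eventually_cube_mul_le (hv : IsScaledInertialSolution α t₀ f v v') (h0 : 0 ≤ t₀)
    (hconv : ConvexOn ℝ univ f) (hd : Differentiable ℝ f) (hz : z ∈ argmin f) (hα : 3 ≤ α) :
    ∃ K, ∀ᶠ t in atTop, t ^ 3 * (f (v t) - f z) ≤ K := by
  obtain ⟨L, hL⟩ := hv.exists_tendsto_anchoredEnergy h0 hconv hd hz hα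
  refine ⟨4 * (L + 1), ?_⟩
  filter_upwards [hL.eventually_lt_const (lt_add_one L)] with t ht
  unfold anchoredEnergy at ht
  nlinarith [sq_nonneg ‖α • (v t - z) + t • v' t‖]

theorem tendsto_mechanicalEnergy (hv : IsScaledInertialSolution α t₀ f v v') (h0 : 0 ≤ t₀)
    (hconv : ConvexOn ℝ univ f) (hd : Differentiable ℝ f) (hz : z ∈ argmin f) (hα : 3 < α) :
    Tendsto (mechanicalEnergy f z v v') atTop (𝓝 0) := by
  -- With this c the dissipation is (7/4)t²(f(v) - f(z)); after absorbing the growth 3/4, a full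
  -- unit remains, more than the 1/4 needed for W/t.
  set c : ℝ := 7 / (α - 3) with hc
  have hα3 : 0 < α - 3 := by linarith
  have hc0 : 0 < c := by positivity
  set F : ℝ → ℝ := fun t => mechanicalEnergy f z v v' t + c * anchoredEnergy α f z v v' t with hF
  have hFd := fun t (ht : t₀ < t) => (hv.hasDerivAt_mechanicalEnergy h0 hd z ht).add
    ((hv.hasDerivAt_anchoredEnergy h0 hd z ht).const_mul c)
  have hF0 : ∀ t, t₀ < t → 0 ≤ F t := fun t ht =>
    add_nonneg (mechanicalEnergy_nonneg hz (h0.trans ht.le))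
      (mul_nonneg hc0.le (anchoredEnergy_nonneg hz (h0.trans ht.le)))
  have hF' : ∀ t, t₀ < t → (3 / 4 * t ^ 2 * (f (v t) - f z) - α * t * ‖v' t‖ ^ 2) +
      c * (3 / 4 * t ^ 2 * (f (v t) - f z)
        - α / 4 * t ^ 2 * inner ℝ (gradient f (v t)) (v t - z))
      ≤ -(mechanicalEnergy f z v v' t / t) := by
    intro t ht
    have ht0 : 0 < t := h0.trans_lt ht
    have h1 := mul_le_mul_of_nonneg_left
      (anchoredEnergy_deriv_le hconv hd (show 0 ≤ α by linarith) z v t) hc0.le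
    have h2 : c * -((α - 3) / 4 * (t ^ 2 * (f (v t) - f z)))
        = -(7 / 4 * (t ^ 2 * (f (v t) - f z))) := by
      rw [hc]
      field_simp
    have h3 : mechanicalEnergy f z v v' t / t
        = t ^ 2 / 4 * (f (v t) - f z) + t / 2 * ‖v' t‖ ^ 2 := by
      unfold mechanicalEnergy
      field_simp
    have h4 : 0 ≤ t ^ 2 * (f (v t) - f z) :=
      mul_nonneg (by positivity) (sub_nonneg.2 (hz (mem_univ (v t))))
    have h5 : 0 ≤ (α - 1 / 2) * (t * ‖v' t‖ ^ 2) := mul_nonneg (by linarith) (by positivity)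
    rw [h3]
    linarith
  have hanti : AntitoneOn F (Ioi t₀) := antitoneOn_Ioi_of_hasDerivAt_nonpos hFd fun t ht =>
    (hF' t ht).trans (neg_nonpos.2
      (div_nonneg (mechanicalEnergy_nonneg hz (h0.trans ht.le)) (h0.trans ht.le)))
  obtain ⟨L, hL⟩ := exists_tendsto_of_antitoneOn_Ioi hanti hF0
  obtain ⟨M, hM⟩ := hv.exists_tendsto_anchoredEnergy h0 hconv hd hz hα.le
  have hlim : Tendsto (mechanicalEnergy f z v v') atTop (𝓝 (L - c * M)) :=
    (hL.sub (hM.const_mul c)).congr fun t => by simp [hF]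
  have hnn : 0 ≤ L - c * M := ge_of_tendsto hlim <| by
    filter_upwards [eventually_gt_atTop t₀] with t ht
    exact mechanicalEnergy_nonneg hz (h0.trans ht.le)
  rcases hnn.eq_or_lt with h | h
  · rwa [← h] at hlim
  -- A positive limit of W would force F' ≤ -const/t, against F ≥ 0.
  · obtain ⟨b, hb⟩ := eventually_atTop.1 (hlim.eventually_const_lt (half_lt_self h))
    refine (not_hasDerivAt_le_neg_div (a := max t₀ b) (B := 0) (h0.trans (le_max_left _ _))
      (half_pos h) (fun t ht => hFd t ((le_max_left _ _).trans_lt ht))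
      (fun t ht => hF0 t ((le_max_left _ _).trans_lt ht)) fun t ht => ?_).elim
    have ht0 : 0 < t := h0.trans_lt ((le_max_left _ _).trans_lt ht)
    refine (hF' t ((le_max_left _ _).trans_lt ht)).trans (neg_le_neg ?_)
    gcongr
    exact (hb t ((le_max_right _ _).trans ht.le)).le

theorem tendsto_cube_mul (hv : IsScaledInertialSolution α t₀ f v v') (h0 : 0 ≤ t₀)
    (hconv : ConvexOn ℝ univ f) (hd : Differentiable ℝ f) (hz : z ∈ argmin f) (hα : 3 < α) :
    Tendsto (fun t => t ^ 3 * (f (v t) - f z)) atTop (𝓝 0) := by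
  have h := (hv.tendsto_mechanicalEnergy h0 hconv hd hz hα).const_mul 4
  rw [mul_zero] at h
  refine squeeze_zero' ?_ ?_ h
  · filter_upwards [eventually_ge_atTop 0] with t ht
    exact mul_nonneg (by positivity) (sub_nonneg.2 (hz (mem_univ (v t))))
  · refine Eventually.of_forall fun t => ?_
    unfold mechanicalEnergy
    nlinarith [mul_nonneg (sq_nonneg t) (sq_nonneg ‖v' t‖)]

theorem tendsto_smul_deriv (hv : IsScaledInertialSolution α t₀ f v v') (h0 : 0 ≤ t₀)
    (hconv : ConvexOn ℝ univ f) (hd : Differentiable ℝ f) (hz : z ∈ argmin f) (hα : 3 < α) :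
    Tendsto (fun t => t • v' t) atTop (𝓝 0) := by
  have h := (hv.tendsto_mechanicalEnergy h0 hconv hd hz hα).const_mul 2
  rw [mul_zero] at h
  have hsq : Tendsto (fun t => ‖t • v' t‖ ^ 2) atTop (𝓝 0) := by
    refine squeeze_zero' (Eventually.of_forall fun t => by positivity) ?_ h
    filter_upwards [eventually_ge_atTop 0] with t ht
    have : 0 ≤ t ^ 3 * (f (v t) - f z) :=
      mul_nonneg (by positivity) (sub_nonneg.2 (hz (mem_univ (v t))))
    rw [norm_smul, mul_pow, Real.norm_eq_abs, sq_abs, mechanicalEnergy]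
    linarith
  have := hsq.sqrt
  simp only [Real.sqrt_sq (norm_nonneg _), Real.sqrt_zero] at this
  exact tendsto_zero_iff_norm_tendsto_zero.2 this

/-- The potential part of the anchored energy vanishes in the limit, so ‖α(v - z) + tv'‖ converges;
removing tv' → 0 leaves α‖v - z‖. -/
theorem exists_tendsto_norm_sub_sq (hv : IsScaledInertialSolution α t₀ f v v') (h0 : 0 ≤ t₀)
    (hconv : ConvexOn ℝ univ f) (hd : Differentiable ℝ f) (hz : z ∈ argmin f) (hα : 3 < α) :
    ∃ c, Tendsto (fun t => ‖v t - z‖ ^ 2) atTop (𝓝 c) := by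
  obtain ⟨L, hL⟩ := hv.exists_tendsto_anchoredEnergy h0 hconv hd hz hα.le
  have hM := hv.tendsto_mechanicalEnergy h0 hconv hd hz hα
  have hs := hv.tendsto_smul_deriv h0 hconv hd hz hα
  have hα0 : 0 < α := by linarith
  have hN : Tendsto (fun t => ‖α • (v t - z) + t • v' t‖ ^ 2) atTop (𝓝 (2 * L)) := by
    have hp := (hv.tendsto_cube_mul h0 hconv hd hz hα).div_const 4
    have := (hL.sub hp).const_mul 2
    rw [zero_div, sub_zero] at this
    refine this.congr fun t => ?_
    rw [anchoredEnergy]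
    ring
  have hcross : Tendsto (fun t => inner ℝ (α • (v t - z) + t • v' t) (t • v' t)) atTop (𝓝 0) := by
    have hn := hN.sqrt.mul hs.norm
    simp only [Real.sqrt_sq (norm_nonneg _), norm_zero, mul_zero] at hn
    exact squeeze_zero_norm (fun t => norm_inner_le_norm _ _) hn
  have hs2 := hs.norm.pow 2
  rw [norm_zero] at hs2
  refine ⟨_, (((hN.sub (hcross.const_mul 2)).add hs2).div_const (α ^ 2)).congr fun t => ?_⟩
  have : ‖α • (v t - z)‖ ^ 2 = ‖α • (v t - z) + t • v' t‖ ^ 2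
      - 2 * inner ℝ (α • (v t - z) + t • v' t) (t • v' t) + ‖t • v' t‖ ^ 2 := by
    rw [← norm_sub_sq_real, add_sub_cancel_right]
  rw [← this, norm_smul, mul_pow, Real.norm_eq_abs, sq_abs]
  field_simp

theorem exists_weak_limit (hv : IsScaledInertialSolution α t₀ f v v') (h0 : 0 ≤ t₀)
    (hconv : ConvexOn ℝ univ f) (hd : Differentiable ℝ f) (hmin : (argmin f).Nonempty)
    (hα : 3 < α) :
    ∃ x ∈ argmin f, ∀ h : H, Tendsto (fun t => inner ℝ (v t) h) atTop (𝓝 (inner ℝ x h)) := by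
  refine exists_weak_limit_of_opial hmin
    (fun z hz => hv.exists_tendsto_norm_sub_sq h0 hconv hd hz hα) fun U hU x hx => ?_
  obtain ⟨z, hz⟩ := hmin
  have hfv : Tendsto (fun t => f (v t)) atTop (𝓝 (f z)) := by
    have h := ((hv.tendsto_cube_mul h0 hconv hd hz hα).div_atTop
      (tendsto_pow_atTop (three_ne_zero))).add_const (f z)
    rw [zero_add] at h
    refine h.congr' ?_
    filter_upwards [eventually_gt_atTop 0] with t ht
    field_simp
    ring
  -- Weak lower semicontinuity at x, read off the tangent minorant of f, which is weakly continuous.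
  have hin : Tendsto (fun t => f x + inner ℝ (gradient f x) (v t - x)) U (𝓝 (f x)) := by
    have h := ((hx (gradient f x)).sub_const (inner ℝ x (gradient f x))).const_add (f x)
    rw [sub_self, add_zero] at h
    refine h.congr fun t => ?_
    rw [real_inner_comm (v t - x), inner_sub_left]
  have hle : f x ≤ f z := le_of_tendsto_of_tendsto' hin (hfv.mono_left hU)
    fun t => hconv.inner_gradient_le (hd x).hasGradientAt (v t)
  exact fun y hy => hle.trans (hz hy)

end IsScaledInertialSolution

end Dynamics

/-! ### Reduction of the third order equation -/

section Reduction

variable {H : Type*} [NormedAddCommGroup H] [InnerProductSpace ℝ H] [CompleteSpace H]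

theorem ContDiffOn.hasDerivAt_iteratedDerivWithin_Ici {E : Type*} [NormedAddCommGroup E]
    [NormedSpace ℝ E] {t₀ t : ℝ} {n k : ℕ} {u : ℝ → E} (hu : ContDiffOn ℝ n u (Ici t₀))
    (hk : k < n) (ht : t₀ < t) :
    HasDerivAt (iteratedDerivWithin k u (Ici t₀)) (iteratedDerivWithin (k + 1) u (Ici t₀) t) t := by
  rw [iteratedDerivWithin_succ]
  exact ((hu.differentiableOn_iteratedDerivWithin (by exact_mod_cast hk) (uniqueDiffOn_Ici t₀) t
    ht.le).hasDerivWithinAt).hasDerivAt (Ici_mem_nhds ht)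

namespace IsTogesVSolution

variable {α t₀ : ℝ} {f : H → ℝ} {u : ℝ → H}

theorem hasDerivAt (hu : IsTogesVSolution α t₀ f u) {t : ℝ} (ht : t₀ < t) :
    HasDerivAt u (derivWithin u (Ici t₀) t) t := by
  have h := hu.contDiffOn.hasDerivAt_iteratedDerivWithin_Ici (n := 3) (k := 0) (by norm_num) ht
  rwa [iteratedDerivWithin_zero, zero_add, iteratedDerivWithin_one] at h

theorem isScaledInertialSolution (hu : IsTogesVSolution α t₀ f u) (ht₀ : 0 < t₀) :
    IsScaledInertialSolution α t₀ f (fun t => u t + (t / 4) • derivWithin u (Ici t₀) t)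
      (fun t => (5 / 4 : ℝ) • derivWithin u (Ici t₀) t
        + (t / 4) • iteratedDerivWithin 2 u (Ici t₀) t) := by
  have h1 : ∀ t, t₀ < t → HasDerivAt (derivWithin u (Ici t₀))
      (iteratedDerivWithin 2 u (Ici t₀) t) t := fun t ht => by
    have h := hu.contDiffOn.hasDerivAt_iteratedDerivWithin_Ici (n := 3) (k := 1) (by norm_num) ht
    have he : iteratedDerivWithin 1 u (Ici t₀) = derivWithin u (Ici t₀) :=
      iteratedDerivWithin_one
    rwa [he] at h
  have h2 : ∀ t, t₀ < t → HasDerivAt (iteratedDerivWithin 2 u (Ici t₀))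
      (iteratedDerivWithin 3 u (Ici t₀) t) t := fun t ht =>
    hu.contDiffOn.hasDerivAt_iteratedDerivWithin_Ici (n := 3) (k := 2) (by norm_num) ht
  constructor
  · intro t ht
    refine ((hu.hasDerivAt ht).add (((hasDerivAt_id t).div_const 4).smul (h1 t ht))).congr_deriv ?_
    simp only [id]
    module
  · intro t ht
    have ht0 : t ≠ 0 := (ht₀.trans ht).ne'
    refine (((h1 t ht).const_smul (5 / 4 : ℝ)).add
      (((hasDerivAt_id t).div_const 4).smul (h2 t ht))).congr_deriv ?_
    have h3 := eq_neg_of_add_eq_zero_right (hu.eqn t ht.le)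
    simp only [id]
    rw [h3]
    match_scalars <;> field_simp <;> ring

/-- The value along `u` is controlled by the value along `u + (t / 4) u'`. -/
theorem eventually_cube_mul_le (hu : IsTogesVSolution α t₀ f u) (ht₀ : 0 < t₀)
    (hconv : ConvexOn ℝ univ f) (hd : Differentiable ℝ f) {m K ε : ℝ}
    (hK : ∀ᶠ t in atTop, t ^ 3 * (f (u t + (t / 4) • derivWithin u (Ici t₀) t) - m) ≤ K)
    (hε : 0 < ε) :
    ∀ᶠ t in atTop, t ^ 3 * (f (u t) - m) ≤ 4 * K + ε := by
  have hy : ∀ t, t₀ < t → HasDerivAt (fun s => s ^ 3 * (f (u s) - m))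
      (3 * t ^ 2 * (f (u t) - m)
        + t ^ 3 * inner ℝ (gradient f (u t)) (derivWithin u (Ici t₀) t)) t := fun t ht => by
    simpa using (hasDerivAt_pow 3 t).fun_mul
      (((hd (u t)).hasGradientAt.comp_hasDerivAt' (hu.hasDerivAt ht)).sub_const m)
  -- With y = t³(f(u) - m), the factor t³ uses up three of the four units of damping: y + ty' =
  -- 4t³(f(u) - m) + t⁴⟨∇f(u), u'⟩ ≤ 4K. Hence n = 0.
  have h := eventually_le_of_damped_ineq (n := 0) (K := 4 * K) ht₀.le hy ?_ hε
  · simpa using h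
  · filter_upwards [hK, eventually_gt_atTop 0] with t htK ht
    have hg := hconv.inner_gradient_le (hd (u t)).hasGradientAt
      (u t + (t / 4) • derivWithin u (Ici t₀) t)
    rw [add_sub_cancel_left, real_inner_smul_right] at hg
    have := mul_le_mul_of_nonneg_left hg (show 0 ≤ t ^ 3 by positivity)
    push_cast
    linarith

theorem tendsto_cube_mul (hu : IsTogesVSolution α t₀ f u) (ht₀ : 0 < t₀)
    (hconv : ConvexOn ℝ univ f) (hd : Differentiable ℝ f) {m : ℝ} (hm : ∀ x, m ≤ f x)
    (h : Tendsto (fun t => t ^ 3 * (f (u t + (t / 4) • derivWithin u (Ici t₀) t) - m)) atTop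
      (𝓝 0)) :
    Tendsto (fun t => t ^ 3 * (f (u t) - m)) atTop (𝓝 0) := by
  refine tendsto_order.2 ⟨fun l hl => ?_, fun r hr => ?_⟩
  · filter_upwards [eventually_ge_atTop 0] with t ht
    exact hl.trans_le (mul_nonneg (by positivity) (sub_nonneg.2 (hm _)))
  · filter_upwards [hu.eventually_cube_mul_le ht₀ hconv hd
      (h.eventually_le_const (show 0 < r / 8 by positivity)) (show 0 < r / 4 by positivity)]
      with t ht
    linarith

theorem tendsto_inner (hu : IsTogesVSolution α t₀ f u) (ht₀ : 0 < t₀) {x h : H}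
    (hv : Tendsto (fun t => inner ℝ (u t + (t / 4) • derivWithin u (Ici t₀) t) h) atTop
      (𝓝 (inner ℝ x h))) :
    Tendsto (fun t => inner ℝ (u t) h) atTop (𝓝 (inner ℝ x h)) := by
  have hy : ∀ t, t₀ < t → HasDerivAt (fun s => inner ℝ (u s) h - inner ℝ x h)
      (inner ℝ (derivWithin u (Ici t₀) t) h) t := fun t ht => by
    simpa using ((hu.hasDerivAt ht).inner ℝ (hasDerivAt_const t h)).sub_const (inner ℝ x h)
  -- Here 4u + tu' = 4v is used without a weight, so n + 1 = 4.
  refine tendsto_sub_nhds_zero_iff.1 (tendsto_zero_of_damped (n := 3) ht₀.le hy ?_)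
  have h0 := (tendsto_sub_nhds_zero_iff.2 hv).const_mul 4
  rw [mul_zero] at h0
  refine h0.congr fun t => ?_
  rw [inner_add_left, real_inner_smul_left]
  push_cast
  ring

end IsTogesVSolution

/-! ### Landau symbols and conclusion -/

theorem isBigO_one_div_cube {g : ℝ → ℝ} {K : ℝ} (hg : ∀ t, 0 ≤ g t)
    (h : ∀ᶠ t in atTop, t ^ 3 * g t ≤ K) : g =O[atTop] fun t : ℝ => 1 / t ^ 3 := by
  refine IsBigO.of_bound K ?_
  filter_upwards [h, eventually_gt_atTop 0] with t ht ht0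
  have : 0 < t ^ 3 := by positivity
  rw [Real.norm_of_nonneg (hg t), Real.norm_of_nonneg (by positivity), mul_one_div,
    le_div_iff₀ this, mul_comm]
  exact ht

theorem isLittleO_one_div_cube {g : ℝ → ℝ} (h : Tendsto (fun t => t ^ 3 * g t) atTop (𝓝 0)) :
    g =o[atTop] fun t : ℝ => 1 / t ^ 3 := by
  refine (isLittleO_iff_tendsto' ?_).2
    (h.congr fun t => by rw [div_div_eq_mul_div, div_one, mul_comm])
  filter_upwards [eventually_gt_atTop 0] with t ht h0
  exact absurd h0 (by positivity)

end Reduction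

theorem iInf_eq_of_mem_argmin {H : Type*} {f : H → ℝ} {z : H} (hz : z ∈ argmin f) :
    ⨅ x, f x = f z :=
  IsLeast.csInf_eq ⟨mem_range_self z, by rintro _ ⟨x, rfl⟩; exact hz (mem_univ x)⟩

theorem theorem2p1 {H : Type*} [NormedAddCommGroup H] [InnerProductSpace ℝ H] [CompleteSpace H]
    (f : H → ℝ) (hconv : ConvexOn ℝ univ f) (hf : ContDiff ℝ 1 f) (hmin : (argmin f).Nonempty)
    (α t₀ : ℝ) (ht₀ : 0 < t₀) (u : ℝ → H) (hu : IsTogesVSolution α t₀ f u) :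
    (3 ≤ α →
      ((fun t : ℝ => f (u t + (t / 4) • derivWithin u (Ici t₀) t) - ⨅ x, f x)
        =O[atTop] fun t : ℝ => 1 / t ^ 3) ∧
      ((fun t : ℝ => f (u t) - ⨅ x, f x) =O[atTop] fun t : ℝ => 1 / t ^ 3)) ∧
    (3 < α →
      ((fun t : ℝ => f (u t + (t / 4) • derivWithin u (Ici t₀) t) - ⨅ x, f x)
        =o[atTop] fun t : ℝ => 1 / t ^ 3) ∧
      ((fun t : ℝ => f (u t) - ⨅ x, f x) =o[atTop] fun t : ℝ => 1 / t ^ 3) ∧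
      ∃ uinf ∈ argmin f, WeaklyConvergesTo u uinf) := by
  have hd : Differentiable ℝ f := hf.differentiable one_ne_zero
  obtain ⟨z, hz⟩ := hmin
  have hmz : ∀ x, f z ≤ f x := fun x => hz (mem_univ x)
  have hv := hu.isScaledInertialSolution ht₀
  rw [iInf_eq_of_mem_argmin hz]
  refine ⟨fun hα => ?_, fun hα => ?_⟩
  · obtain ⟨K, hK⟩ := hv.eventually_cube_mul_le ht₀.le hconv hd hz hα
    exact ⟨isBigO_one_div_cube (fun t => sub_nonneg.2 (hmz _)) hK,
      isBigO_one_div_cube (fun t => sub_nonneg.2 (hmz _))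
        (hu.eventually_cube_mul_le ht₀ hconv hd hK one_pos)⟩
  · have hlim := hv.tendsto_cube_mul ht₀.le hconv hd hz hα
    obtain ⟨x, hx, hxv⟩ := hv.exists_weak_limit ht₀.le hconv hd ⟨z, hz⟩ hα
    exact ⟨isLittleO_one_div_cube hlim,
      isLittleO_one_div_cube (hu.tendsto_cube_mul ht₀ hconv hd hmz hlim),
      x, hx, weaklyConvergesTo_of_forall_inner fun h => hu.tendsto_inner ht₀ (hxv h)⟩
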